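/- Conventions. Let $k\ge 1$ and let $U\subseteq\mathbb{R}^n$ be open. A $j$-form on $U$ is any map $U\to\Lambda^j(\mathbb{R}^n)^*$ (no regularity assumed). A $j$-block is a product $B=\prod_{i=1}^j[a_{i0},a_{i1}]$ with $a_{i0}<a_{i1}$ (a single point if $j=0$); a singular $j$-block of class $C^1$ in $U$ is a map $c:B\to U$ on a $j$-block which near each point of $B$ is the restriction of a $C^1$ map defined on an open subset of $\mathbb{R}^j$; a $C^1$ $j$-chain in $U$ is a formal finite $\mathbb{Z}$-linear combination of these. For $j\ge 1$ the boundary is $\partial c=\sum_{i=1}^j\sum_{l=0}^1(-1)^{i+l}c_{il}$, where $c_{il}$ is obtained from $c$ by fixing the $i$-th variable equal to $a_{il}$. For a $j$-form $\omega$, $\int_c\omega$ is the Riemann integral over $B$ of the coefficient $(c^*\omega)(e_1,\dots,e_j)$, extended linearly to chains; $\omega$ is integrable on a chain if the integral over each of its singular blocks exists. A block $B\subseteq\mathbb{R}^j$ is identified with the singular block given by the inclusion. A $(k-1)$-form $\omega$ on $U$ is derivable at $x\in U$ if the following two conditions hold. (a) For every $C^1$ map $\varphi:A\to U$ from an open set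 $A\subseteq\mathbb{R}^k$, every $p\in A$ with $\varphi(p)=x$ and every $k$-block $B\subseteq A$ with $p\in B$, the form $\varphi^*\omega$ is integrable on $\partial B$. (b) There is a $k$-form $\mathrm{D}\omega_x\in\Lambda^k(\mathbb{R}^n)^*$ such that, for all $v_1,\dots,v_k\in\mathbb{R}^n$ and all $\varphi:A\to U$, $p$ as in (a) with $\varphi'(p)e_i=v_i$ for $i=1,\dots,k$, one has: for all $\varepsilon>0$ and $K>1$ there is $\delta>0$ such that every $k$-block $B\subseteq A$ with $p\in B$, longest side $L(B)<\delta$ and $L(B)/l(B)<K$ ($l(B)$ being the shortest side) satisfies $$\Bigl|\mathrm{D}\omega_x(v_1,\dots,v_k)-\frac1{\mathrm{vol}(B)}\int_{\partial B}\varphi^*\omega\Bigr|<\varepsilon .$$ The form $\mathrm{D}\omega_x$ is then unique. If $\omega$ is derivable at every point of $U$, it is called derivable on $U$, and $\mathrm{D}\omega$ denotes the resulting $k$-form on $U$. Theorem ($\mathrm{D}^2=0$). Let $k\ge1$, let $U\subseteq\mathbb{R}^n$ be open, and let $\omega$ be a $(k-1)$-form that is continuous on $U$ and derivable on $U$, and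 such that $\mathrm{D}\omega$ is integrable on every $k$-chain of class $C^1$ in $U$. Then $\mathrm{D}\omega$ is derivable on $U$, and $\mathrm{D}(\mathrm{D}\omega)=0$ on $U$. -/

import Mathlib

noncomputable section

namespace FluxForm

open Set BoxIntegral

variable {E : Type*} [NormedAddCommGroup E] [NormedSpace ℝ E]

/-- Differential `k`-forms, with no regularity. A form on an open set `U` is represented by a total
function; only its values on `U` enter the notions below. -/
abbrev DiffForm (E : Type*) [NormedAddCommGroup E] [NormedSpace ℝ E] (k : ℕ) :=
  E → E [⋀^Fin k]→L[ℝ] ℝ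

/-- A map on an arbitrary subset `X` of `ℝ^k` is of class `C¹` if around every point of `X` it is
the restriction of a `C¹` map defined on an open set. -/
def IsC1On {k : ℕ} (f : (Fin k → ℝ) → E) (X : Set (Fin k → ℝ)) : Prop :=
  ∀ x ∈ X, ∃ V : Set (Fin k → ℝ), IsOpen V ∧ x ∈ V ∧
    ∃ F : (Fin k → ℝ) → E, ContDiffOn ℝ 1 F V ∧ EqOn f F (V ∩ X)

/-- A singular `k`-block of class `C¹` in `U`. The `k`-block is the closed box `Box.Icc block`,
a product of nondegenerate compact intervals; for `k = 0` it is a single point. Only the values of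
`toFun` on that box are relevant. -/
structure SingularBlock (U : Set E) (k : ℕ) where
  block : Box (Fin k)
  toFun : (Fin k → ℝ) → E
  isC1On : IsC1On toFun (Box.Icc block)
  mapsTo : MapsTo toFun (Box.Icc block) U

/-- The endpoint `a_{ij}` of the `i`-th side of a block: the lower one for `j = 0`, the upper one
for `j = 1`. -/
def endpoint {k : ℕ} (B : Box (Fin k)) (i : Fin k) (j : Fin 2) : ℝ :=
  if j = 0 then B.lower i else B.upper i

theorem endpoint_mem {k : ℕ} (B : Box (Fin k)) (i : Fin k) (j : Fin 2) :
    endpoint B i j ∈ Icc (B.lower i) (B.upper i) := by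
  unfold endpoint
  split_ifs
  · exact left_mem_Icc.2 (B.lower_le_upper i)
  · exact right_mem_Icc.2 (B.lower_le_upper i)

theorem contDiff_insertNth {m : ℕ} (i : Fin (m + 1)) (a : ℝ) :
    ContDiff ℝ 1 (fun t : Fin m → ℝ => (i.insertNth a t : Fin (m + 1) → ℝ)) := by
  rw [contDiff_pi]
  intro l
  refine Fin.succAboveCases i ?_ (fun l' => ?_) l
  · simpa using contDiff_const
  · simpa using contDiff_apply ℝ ℝ l'

theorem SingularBlock.isC1On_face {U : Set E} {m : ℕ} (c : SingularBlock U (m + 1))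
    (i : Fin (m + 1)) (j : Fin 2) :
    IsC1On (fun t => c.toFun (i.insertNth (endpoint c.block i j) t))
      (Box.Icc (c.block.face i)) := by
  intro t ht
  have hmaps := Box.mapsTo_insertNth_face_Icc (I := c.block) (endpoint_mem c.block i j)
  obtain ⟨V, hV, hxV, F, hF, hcF⟩ := c.isC1On _ (hmaps ht)
  have hι := contDiff_insertNth i (endpoint c.block i j)
  refine ⟨_, hV.preimage hι.continuous, hxV, fun t => F (i.insertNth (endpoint c.block i j) t),
    hF.comp hι.contDiffOn (fun _ h => h), ?_⟩
  intro s hs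
  exact hcF ⟨hs.1, hmaps hs.2⟩

/-- The face `c_{ij}` of a singular block: the `i`-th variable is frozen at `a_{ij}`. -/
def SingularBlock.face {U : Set E} {m : ℕ} (c : SingularBlock U (m + 1)) (i : Fin (m + 1))
    (j : Fin 2) : SingularBlock U m where
  block := c.block.face i
  toFun t := c.toFun (i.insertNth (endpoint c.block i j) t)
  isC1On := c.isC1On_face i j
  mapsTo := fun _ ht =>
    c.mapsTo (Box.mapsTo_insertNth_face_Icc (I := c.block) (endpoint_mem c.block i j) ht)

/-- `C¹` `k`-chains in `U`: formal finite sums of singular `k`-blocks with integer coefficients. -/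
abbrev Chain (U : Set E) (k : ℕ) := SingularBlock U k →₀ ℤ

/-- The boundary `∑ᵢ ∑ⱼ (-1)^(i+j) c_{ij}` of a singular block, where `i` runs over `1, …, k`
(here `i` is counted from `0`, hence the shift by one in the sign). -/
def SingularBlock.boundary {U : Set E} {m : ℕ} (c : SingularBlock U (m + 1)) : Chain U m :=
  ∑ i : Fin (m + 1), ∑ j : Fin 2,
    Finsupp.single (c.face i j) ((-1 : ℤ) ^ ((i : ℕ) + 1 + (j : ℕ)))

/-- The coefficient function of `c^* ω` with respect to `dx¹ ∧ ⋯ ∧ dx^k` on the block of `c`. -/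
def SingularBlock.pullbackCoeff {U : Set E} {k : ℕ} (c : SingularBlock U k) (ω : DiffForm E k) :
    (Fin k → ℝ) → ℝ := fun t =>
  (ω (c.toFun t)).compContinuousLinearMap (fderivWithin ℝ c.toFun (Box.Icc c.block) t)
    (fun i => Pi.single i 1)

/-- The Riemann integral of `c^* ω` over the block of `c` exists. -/
def SingularBlock.IsIntegrable {U : Set E} {k : ℕ} (c : SingularBlock U k) (ω : DiffForm E k) :
    Prop :=
  BoxIntegral.Integrable c.block IntegrationParams.Riemann (c.pullbackCoeff ω)
    BoxAdditiveMap.volume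

/-- The Riemann integral `∫_c ω` over a singular block. -/
def SingularBlock.integral {U : Set E} {k : ℕ} (c : SingularBlock U k) (ω : DiffForm E k) : ℝ :=
  BoxIntegral.integral c.block IntegrationParams.Riemann (c.pullbackCoeff ω) BoxAdditiveMap.volume

/-- A form is integrable on a chain if it is integrable on each of its singular blocks. -/
def Chain.IsIntegrable {U : Set E} {k : ℕ} (c : Chain U k) (ω : DiffForm E k) : Prop :=
  ∀ s ∈ c.support, s.IsIntegrable ω

/-- The integral of a form over a chain. -/
def Chain.integral {U : Set E} {k : ℕ} (c : Chain U k) (ω : DiffForm E k) : ℝ :=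
  c.sum fun s a => (a : ℝ) * s.integral ω

theorem isC1On_id {k : ℕ} (X : Set (Fin k → ℝ)) : IsC1On (id : (Fin k → ℝ) → Fin k → ℝ) X :=
  fun _ _ => ⟨univ, isOpen_univ, mem_univ _, id, contDiff_id.contDiffOn, fun _ _ => rfl⟩

/-- A `k`-block contained in `A ⊆ ℝ^k`, as a singular block in `A` (the inclusion map). -/
def inclusionBlock {k : ℕ} {A : Set (Fin k → ℝ)} (B : Box (Fin k)) (hB : Box.Icc B ⊆ A) :
    SingularBlock A k where
  block := B
  toFun := id
  isC1On := isC1On_id _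
  mapsTo := fun _ h => hB h

/-- The pullback `φ^* ω` of a form under a map from an open subset of `ℝ^k`. -/
def pullback {k l : ℕ} (φ : (Fin k → ℝ) → E) (ω : DiffForm E l) : DiffForm (Fin k → ℝ) l :=
  fun t => (ω (φ t)).compContinuousLinearMap (fderiv ℝ φ t)

/-- The length of the longest side of a block. -/
def longSide {k : ℕ} (B : Box (Fin k)) : ℝ := ⨆ i, (B.upper i - B.lower i)

/-- The length of the shortest side of a block. -/
def shortSide {k : ℕ} (B : Box (Fin k)) : ℝ := ⨅ i, (B.upper i - B.lower i)

/-- The volume of a block. -/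
def vol {k : ℕ} (B : Box (Fin k)) : ℝ := ∏ i, (B.upper i - B.lower i)

/-- `φ : A → U` is a `C¹` map from an open subset `A` of `ℝ^k`, and `p ∈ A` is sent to `x`. -/
structure IsC1Through {k : ℕ} (U : Set E) (x : E) (A : Set (Fin k → ℝ)) (φ : (Fin k → ℝ) → E)
    (p : Fin k → ℝ) : Prop where
  isOpen : IsOpen A
  contDiffOn : ContDiffOn ℝ 1 φ A
  mapsTo : MapsTo φ A U
  mem : p ∈ A
  map_eq : φ p = x

/-- Flux-integrability around `x` of an `m`-form on `U`. -/
def FluxIntegrableAround {m : ℕ} (U : Set E) (ω : DiffForm E m) (x : E) : Prop :=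
  ∀ (A : Set (Fin (m + 1) → ℝ)) (φ : (Fin (m + 1) → ℝ) → E) (p : Fin (m + 1) → ℝ),
    IsC1Through U x A φ p → ∀ (B : Box (Fin (m + 1))) (hB : Box.Icc B ⊆ A), p ∈ Box.Icc B →
      Chain.IsIntegrable (inclusionBlock B hB).boundary (pullback φ ω)

/-- The `m`-form `ω` on `U` is derivable at `x`, with exterior derivative `η`: `η` is the
infinitesimal flux of `ω`, the limit being taken along blocks containing `p` that shrink to `p`
with bounded ratio of longest to shortest side. -/
def HasExtDerivAt {m : ℕ} (U : Set E) (ω : DiffForm E m) (η : E [⋀^Fin (m + 1)]→L[ℝ] ℝ)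
    (x : E) : Prop :=
  FluxIntegrableAround U ω x ∧
  ∀ (v : Fin (m + 1) → E) (A : Set (Fin (m + 1) → ℝ)) (φ : (Fin (m + 1) → ℝ) → E)
    (p : Fin (m + 1) → ℝ), IsC1Through U x A φ p → (∀ i, fderiv ℝ φ p (Pi.single i 1) = v i) →
    ∀ ε > (0 : ℝ), ∀ K > (1 : ℝ), ∃ δ > (0 : ℝ), ∀ (B : Box (Fin (m + 1))) (hB : Box.Icc B ⊆ A),
      p ∈ Box.Icc B → longSide B < δ → longSide B / shortSide B < K →
        |η v - 1 / vol B * Chain.integral (inclusionBlock B hB).boundary (pullback φ ω)| < ε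

/-- Derivability at a point. -/
def DerivableAt {m : ℕ} (U : Set E) (ω : DiffForm E m) (x : E) : Prop :=
  ∃ η, HasExtDerivAt U ω η x

open Classical in
/-- The exterior derivative `D ω` of a form on `U` (with value `0` where `ω` is not derivable). -/
def D {m : ℕ} (U : Set E) (ω : DiffForm E m) : DiffForm E (m + 1) := fun x =>
  if h : DerivableAt U ω x then h.choose else 0

/-- The exterior derivative at a point is unique, so that `D` is well defined. -/
theorem HasExtDerivAt.unique {m : ℕ} {U : Set E} (hU : IsOpen U) {ω : DiffForm E m}
    {η η' : E [⋀^Fin (m + 1)]→L[ℝ] ℝ} {x : E} (hx : x ∈ U) (h : HasExtDerivAt U ω η x)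
    (h' : HasExtDerivAt U ω η' x) : η = η' := by
  ext v
  by_contra hne
  let L : (Fin (m + 1) → ℝ) →L[ℝ] E :=
    ∑ i, (ContinuousLinearMap.proj (R := ℝ) (φ := fun _ : Fin (m + 1) => ℝ) i).smulRight (v i)
  let φ : (Fin (m + 1) → ℝ) → E := fun t => x + L t
  have hφ : ContDiff ℝ 1 φ := contDiff_const.add L.contDiff
  have hd : ∀ i, fderiv ℝ φ 0 (Pi.single i 1) = v i := by
    intro i
    have : HasFDerivAt φ L 0 := L.hasFDerivAt.const_add x
    rw [this.fderiv]
    simp [L, Pi.single_apply]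
  have hA : IsC1Through U x (φ ⁻¹' U) φ 0 :=
    ⟨hU.preimage hφ.continuous, hφ.contDiffOn, fun _ h => h, by simpa [φ] using hx, by simp [φ]⟩
  have hε : 0 < |η v - η' v| / 2 := half_pos (abs_pos.2 (sub_ne_zero.2 hne))
  obtain ⟨δ, hδ, H⟩ := h.2 v _ φ 0 hA hd _ hε 2 one_lt_two
  obtain ⟨δ', hδ', H'⟩ := h'.2 v _ φ 0 hA hd _ hε 2 one_lt_two
  obtain ⟨r, hr, hball⟩ := Metric.isOpen_iff.1 hA.isOpen 0 hA.mem
  set s : ℝ := min (min δ δ') r / 2 with hs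
  have hmin : 0 < min (min δ δ') r := lt_min (lt_min hδ hδ') hr
  have hs0 : 0 < s := half_pos hmin
  have hsm : s < min (min δ δ') r := half_lt_self hmin
  let B : Box (Fin (m + 1)) := ⟨fun _ => 0, fun _ => s, fun _ => hs0⟩
  have hB : Box.Icc B ⊆ φ ⁻¹' U := by
    intro t ht
    apply hball
    rw [mem_ball_zero_iff, pi_norm_lt_iff hr]
    intro i
    have h0 : 0 ≤ t i := ht.1 i
    have h1 : t i ≤ s := ht.2 i
    rw [Real.norm_eq_abs, abs_of_nonneg h0]
    exact lt_of_le_of_lt h1 (hsm.trans_le (min_le_right _ _))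
  have hp : (0 : Fin (m + 1) → ℝ) ∈ Box.Icc B := ⟨fun _ => le_rfl, fun _ => hs0.le⟩
  have hL : longSide B = s := by simp [longSide, B]
  have hl : shortSide B = s := by simp [shortSide, B]
  have hr1 : longSide B / shortSide B < 2 := by
    rw [hL, hl, div_self hs0.ne']; exact one_lt_two
  have e1 := H B hB hp (by rw [hL]; exact hsm.trans_le ((min_le_left _ _).trans (min_le_left _ _)))
    hr1
  have e2 := H' B hB hp
    (by rw [hL]; exact hsm.trans_le ((min_le_left _ _).trans (min_le_right _ _))) hr1
  rw [abs_sub_comm] at e2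
  have := abs_sub_le (η v) (1 / vol B * Chain.integral (inclusionBlock B hB).boundary (pullback φ ω))
    (η' v)
  linarith

end FluxForm

end

/-!
By definition `D ω` is the infinitesimal density, along regularly shrinking blocks, of the block
function `J ↦ ∫_{∂J} φ^* ω`. This function is additive, so the fundamental theorem for the
generalized Perron integral gives Stokes' formula `∫_c D ω = ∫_{∂c} ω` for every block `c` that is
`C¹` on a neighbourhood of its box; the Riemann integrability of `D ω` makes the two integrals
agree. Applied to the faces of a block `φ|_B`, this gives `∫_{∂B} φ^* D ω = ∫_{∂∂(φ|_B)} ω = 0`.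
Hence the flux of `D ω` through the boundary of every block vanishes, and so does its density.
-/

namespace FluxForm

open Set BoxIntegral Filter Topology

section BoxIntegral

theorem uniqueDiffOn_boxIcc {ι : Type*} [Finite ι] (I : Box ι) : UniqueDiffOn ℝ (Box.Icc I) := by
  rw [Box.Icc_eq_pi]
  exact UniqueDiffOn.univ_pi fun i => uniqueDiffOn_Icc (I.lower_lt_upper i)

variable {ι E F : Type*} [Fintype ι] [NormedAddCommGroup E] [NormedSpace ℝ E]
  [NormedAddCommGroup F] [NormedSpace ℝ F] {I : Box ι} {l : IntegrationParams}
  {f g : (ι → ℝ) → E} {vol : BoxAdditiveMap ι (E →L[ℝ] F) ⊤}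

theorem integrable_congr (h : EqOn f g (Box.Icc I)) :
    Integrable I l f vol ↔ Integrable I l g vol :=
  exists_congr fun y => hasIntegral_congr I l h (fun _ _ => rfl) y

theorem integral_congr (h : EqOn f g (Box.Icc I)) :
    integral I l f vol = integral I l g vol := by
  by_cases hg : Integrable I l g vol
  · exact ((hasIntegral_congr I l h (fun _ _ => rfl) _).2 hg.hasIntegral).integral_eq
  · rw [integral, integral, dif_neg (mt (integrable_congr h).1 hg), dif_neg hg]

end BoxIntegral

section InfinitesimalDensity

variable {k : ℕ}

theorem longSide_le_dist (B : Box (Fin k)) : longSide B ≤ dist B.lower B.upper :=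
  Real.iSup_le (fun i => calc
    B.upper i - B.lower i ≤ dist (B.lower i) (B.upper i) := by
      rw [dist_comm, Real.dist_eq]; exact le_abs_self _
    _ ≤ dist B.lower B.upper := dist_le_pi_dist _ _ i) dist_nonneg

theorem longSide_div_shortSide_le_distortion (B : Box (Fin k)) :
    longSide B / shortSide B ≤ B.distortion := by
  rcases isEmpty_or_nonempty (Fin k) with _ | _
  · simp [longSide]
  · obtain ⟨i, hi⟩ := exists_eq_ciInf_of_finite (f := fun i => B.upper i - B.lower i)
    rw [shortSide, ← hi, div_le_iff₀ (sub_pos.2 (B.lower_lt_upper i))]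
    exact (longSide_le_dist B).trans (B.dist_le_distortion_mul i)

theorem vol_pos (B : Box (Fin k)) : 0 < vol B :=
  Finset.prod_pos fun i _ => sub_pos.2 (B.lower_lt_upper i)

/-- The box function `F` has infinitesimal density `a` at `p` inside `I`: `F J / vol J` tends to `a`
along the sub-boxes `J` of `I` that contain `p` and shrink to `p` with bounded ratio of longest to
shortest side. -/
def HasDensityAt (F : Box (Fin k) → ℝ) (I : Box (Fin k)) (a : ℝ) (p : Fin k → ℝ) : Prop :=
  ∀ ε > (0 : ℝ), ∀ K > (1 : ℝ), ∃ δ > (0 : ℝ), ∀ J ≤ I, p ∈ Box.Icc J →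
    longSide J < δ → longSide J / shortSide J < K → |a - 1 / vol J * F J| < ε

theorem hasIntegral_of_hasDensityAt {I : Box (Fin k)} (F : BoxAdditiveMap (Fin k) ℝ I)
    {f : (Fin k → ℝ) → ℝ} (h : ∀ p ∈ Box.Icc I, HasDensityAt F I (f p) p) :
    HasIntegral I IntegrationParams.GP f BoxAdditiveMap.volume (F I) := by
  refine HasIntegral.of_le_Henstock_of_forall_isLittleO IntegrationParams.gp_le
    ((MeasureTheory.volume : MeasureTheory.Measure (Fin k → ℝ)).toBoxAdditive.restrict _
      le_top) (fun J => ENNReal.toReal_nonneg) F ∅ countable_empty (by simp) ?_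
  intro c p hp ε hε
  obtain ⟨δ, hδ, H⟩ := h p hp.1 ε hε (c + 2) (by linarith [c.coe_nonneg])
  refine ⟨δ / 3, by positivity, fun J hJ hJδ hpJ hc => ?_⟩
  have hlong : longSide J < δ := calc
    longSide J ≤ dist J.lower J.upper := longSide_le_dist J
    _ ≤ dist J.lower p + dist J.upper p := dist_triangle_right _ _ _
    _ ≤ δ / 3 + δ / 3 := add_le_add (hJδ J.lower_mem_Icc) (hJδ J.upper_mem_Icc)
    _ < δ := by linarith
  have hratio : longSide J / shortSide J < c + 2 := calc
    longSide J / shortSide J ≤ J.distortion := longSide_div_shortSide_le_distortion J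
    _ ≤ c := hc rfl
    _ < c + 2 := by linarith
  have hvol := vol_pos J
  have hvolume : (MeasureTheory.volume : MeasureTheory.Measure (Fin k → ℝ)).toBoxAdditive.restrict
      (I : WithTop (Box (Fin k))) le_top J = vol J := Box.volume_apply J
  rw [hvolume, BoxAdditiveMap.volume_apply, Real.dist_eq, smul_eq_mul]
  calc |vol J * f p - F J| = |(f p - 1 / vol J * F J) * vol J| := by congr 1; field_simp
    _ = |f p - 1 / vol J * F J| * vol J := by rw [abs_mul, abs_of_pos hvol]
    _ ≤ ε * vol J := by gcongr; exact (H J hJ hpJ hlong hratio).le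

end InfinitesimalDensity

section Faces

variable {m : ℕ}

theorem insertNth_insertNth_eq_swap {α : Type*} (i : Fin (m + 2)) (j : Fin (m + 1)) (a b : α)
    (s : Fin m → α) :
    (i.insertNth a (j.insertNth b s : Fin (m + 1) → α) : Fin (m + 2) → α) =
      (i.succAbove j).insertNth b ((j.predAbove i).insertNth a s : Fin (m + 1) → α) := by
  rw [Fin.eq_insertNth_iff, Fin.eq_insertNth_iff]
  refine ⟨by simp, ?_, ?_⟩
  · simp [Fin.removeNth, Fin.succAbove_succAbove_predAbove]
  · rw [← Fin.removeNth_removeNth_eq_swap, Fin.removeNth_insertNth, Fin.removeNth_insertNth]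

theorem face_face_eq_swap (B : Box (Fin (m + 2))) (i : Fin (m + 2)) (j : Fin (m + 1)) :
    (B.face i).face j = (B.face (i.succAbove j)).face (j.predAbove i) := by
  rcases B with ⟨l, u, h⟩
  simp only [Box.face_mk, Box.mk.injEq]
  exact ⟨Fin.removeNth_removeNth_eq_swap l j i, Fin.removeNth_removeNth_eq_swap u j i⟩

theorem endpoint_face (B : Box (Fin (m + 1))) (i : Fin (m + 1)) (l : Fin m) (j : Fin 2) :
    endpoint (B.face i) l j = endpoint B (i.succAbove l) j := rfl

theorem exists_le_face_eq_endpoint_eq (B : Box (Fin (m + 1))) (i : Fin (m + 1)) {a : ℝ}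
    (ha : a ∈ Icc (B.lower i) (B.upper i)) :
    ∃ J ≤ B, J.face i = B.face i ∧ ∃ j, endpoint J i j = a := by
  rcases ha.1.eq_or_lt with rfl | hlt
  · exact ⟨B, le_rfl, rfl, 0, if_pos rfl⟩
  · refine ⟨⟨B.lower, Function.update B.upper i a, fun l => ?_⟩, ?_, ?_, 1, ?_⟩
    · rcases eq_or_ne l i with rfl | hl
      · simpa using hlt
      · simp [hl, B.lower_lt_upper l]
    · exact Box.le_iff_bounds.2 ⟨le_rfl, update_le_iff.2 ⟨ha.2, fun _ _ => le_rfl⟩⟩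
    · rcases B with ⟨l, u, h⟩
      simp only [Box.face_mk, Box.mk.injEq, true_and]
      ext l
      simp
    · simp [endpoint]

theorem fderiv_insertNth_single (i : Fin (m + 1)) (a : ℝ) (t : Fin m → ℝ) (l : Fin m) :
    fderiv ℝ (fun t : Fin m → ℝ => (i.insertNth a t : Fin (m + 1) → ℝ)) t (Pi.single l 1) =
      Pi.single (i.succAbove l) 1 := by
  have hd := (contDiff_insertNth i a).differentiable one_ne_zero t
  have hcoord (q : Fin (m + 1)) :
      fderiv ℝ (fun t : Fin m → ℝ => (i.insertNth a t : Fin (m + 1) → ℝ)) t (Pi.single l 1) q =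
        fderiv ℝ (fun t : Fin m → ℝ => (i.insertNth a t : Fin (m + 1) → ℝ) q) t
          (Pi.single l 1) := by
    rw [fderiv_apply hd, ContinuousLinearMap.comp_apply, ContinuousLinearMap.proj_apply]
  ext q
  rw [hcoord]
  refine Fin.succAboveCases i ?_ (fun q' => ?_) q
  · simp
  · simp [Pi.single_apply, (hasFDerivAt_apply q' t).fderiv]

end Faces

section BoundaryOfBoundary

theorem sum_neg_one_pow_smul_eq_zero {m : ℕ} {M : Type*} [AddCommGroup M]
    (T : Fin (m + 2) → Fin (m + 1) → M)
    (hT : ∀ i j, T i j = T (i.succAbove j) (j.predAbove i)) :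
    ∑ i : Fin (m + 2), ∑ j : Fin (m + 1), (-1 : ℤ) ^ ((i : ℕ) + (j : ℕ)) • T i j = 0 := by
  rw [← Finset.sum_product']
  refine Finset.sum_involution (fun q _ => (q.1.succAbove q.2, q.2.predAbove q.1)) ?_ ?_ ?_ ?_
  · rintro ⟨i, j⟩ -
    simp only [← hT, Fin.neg_one_pow_succAbove_add_predAbove, neg_smul, add_neg_cancel]
  · rintro ⟨i, j⟩ - - h
    exact Fin.succAbove_ne i j (Prod.ext_iff.1 h).1
  · simp
  · rintro ⟨i, j⟩ -
    have h := Fin.succAbove_succAbove_predAbove i j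
    refine Prod.ext h (Fin.succAbove_right_injective (p := i) ?_)
    have h' := Fin.succAbove_succAbove_predAbove (i.succAbove j) (j.predAbove i)
    rwa [h] at h'

variable {E : Type*} [NormedAddCommGroup E] [NormedSpace ℝ E] {U : Set E} {k m : ℕ}

/-- The boundary operator `∂` on chains, the linear extension of `SingularBlock.boundary`. -/
noncomputable def Chain.boundary : Chain U (m + 1) →ₗ[ℤ] Chain U m :=
  Finsupp.linearCombination ℤ SingularBlock.boundary

theorem SingularBlock.face_face_eq_swap (c : SingularBlock U (m + 2)) (i : Fin (m + 2))
    (i' : Fin (m + 1)) (j j' : Fin 2) :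
    (c.face i j).face i' j' = (c.face (i.succAbove i') j').face (i'.predAbove i) j := by
  have hendpoint : endpoint (c.block.face (i.succAbove i')) (i'.predAbove i) j =
      endpoint c.block i j := by
    rw [endpoint_face, Fin.succAbove_succAbove_predAbove]
  simp only [SingularBlock.face, SingularBlock.mk.injEq]
  refine ⟨FluxForm.face_face_eq_swap c.block i i', funext fun s => ?_⟩
  rw [insertNth_insertNth_eq_swap, hendpoint, endpoint_face]

theorem SingularBlock.boundary_boundary (c : SingularBlock U (m + 2)) :
    Chain.boundary c.boundary = 0 := by
  have hexpand : Chain.boundary c.boundary = ∑ i : Fin (m + 2), ∑ i' : Fin (m + 1),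
      (-1 : ℤ) ^ ((i : ℕ) + (i' : ℕ)) • ∑ j : Fin 2, ∑ j' : Fin 2,
        Finsupp.single ((c.face i j).face i' j') ((-1 : ℤ) ^ ((j : ℕ) + (j' : ℕ))) := by
    simp only [SingularBlock.boundary, Chain.boundary, map_sum, Finsupp.linearCombination_single,
      Finset.smul_sum, Finsupp.smul_single, smul_eq_mul]
    refine Finset.sum_congr rfl fun i _ => ?_
    rw [Finset.sum_comm]
    refine Finset.sum_congr rfl fun i' _ => Finset.sum_congr rfl fun j _ =>
      Finset.sum_congr rfl fun j' _ => ?_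
    congr 1
    ring
  rw [hexpand]
  refine sum_neg_one_pow_smul_eq_zero _ fun i i' => ?_
  rw [Finset.sum_comm]
  refine Finset.sum_congr rfl fun j' _ => Finset.sum_congr rfl fun j _ => ?_
  rw [c.face_face_eq_swap, add_comm (j : ℕ)]

theorem Chain.integral_eq_linearCombination (c : Chain U k) (ω : DiffForm E k) :
    Chain.integral c ω = Finsupp.linearCombination ℤ (fun s => s.integral ω) c := by
  simp only [Chain.integral, Finsupp.linearCombination_apply, zsmul_eq_mul]

theorem SingularBlock.integral_boundary (c : SingularBlock U (m + 1)) (ω : DiffForm E m) :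
    Chain.integral c.boundary ω =
      ∑ i : Fin (m + 1), ∑ j : Fin 2,
        (-1) ^ ((i : ℕ) + 1 + (j : ℕ)) * (c.face i j).integral ω := by
  simp [Chain.integral_eq_linearCombination, SingularBlock.boundary]

theorem Chain.integral_boundary (c : Chain U (m + 1)) (ω : DiffForm E m) :
    Chain.integral (Chain.boundary c) ω = c.sum fun s a => a * Chain.integral s.boundary ω := by
  rw [Chain.boundary, Finsupp.linearCombination_apply, Chain.integral_eq_linearCombination,
    map_finsuppSum]
  simp only [map_zsmul, zsmul_eq_mul, Chain.integral_eq_linearCombination]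

end BoundaryOfBoundary

section PushForward

variable {E F : Type*} [NormedAddCommGroup E] [NormedSpace ℝ E] [NormedAddCommGroup F]
  [NormedSpace ℝ F] {k : ℕ}

theorem IsC1On.differentiableWithinAt {f : (Fin k → ℝ) → E} {X : Set (Fin k → ℝ)}
    (hf : IsC1On f X) {t : Fin k → ℝ} (ht : t ∈ X) : DifferentiableWithinAt ℝ f X t := by
  obtain ⟨V, hV, htV, G, hG, hfG⟩ := hf t ht
  have hGt : DifferentiableWithinAt ℝ G X t :=
    ((hG.contDiffAt (hV.mem_nhds htV)).differentiableAt one_ne_zero).differentiableWithinAt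
  have heq : f =ᶠ[𝓝[X] t] G :=
    mem_of_superset (inter_mem_nhdsWithin X (hV.mem_nhds htV)) fun s hs => hfG hs.symm
  exact hGt.congr_of_eventuallyEq heq (hfG ⟨htV, ht⟩)

theorem IsC1On.comp {A : Set E} {φ : E → F} {f : (Fin k → ℝ) → E} {X : Set (Fin k → ℝ)}
    (hA : IsOpen A) (hφ : ContDiffOn ℝ 1 φ A) (hf : IsC1On f X) (hfA : MapsTo f X A) :
    IsC1On (φ ∘ f) X := by
  intro t ht
  obtain ⟨V, hV, htV, G, hG, hfG⟩ := hf t ht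
  refine ⟨V ∩ G ⁻¹' A, hG.continuousOn.isOpen_inter_preimage hV hA,
    ⟨htV, show G t ∈ A from hfG ⟨htV, ht⟩ ▸ hfA ht⟩, φ ∘ G,
    hφ.comp (hG.mono inter_subset_left) inter_subset_right, fun s hs => ?_⟩
  exact congrArg φ (hfG ⟨hs.1.1, hs.2⟩)

/-- The push-forward `φ ∘ c` of a singular block `c` in the open set `A` under a `C¹` map
`φ : A → U`. -/
def SingularBlock.map {A : Set E} {U : Set F} {φ : E → F} (c : SingularBlock A k) (hA : IsOpen A)
    (hφ : ContDiffOn ℝ 1 φ A) (hφU : MapsTo φ A U) : SingularBlock U k where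
  block := c.block
  toFun := φ ∘ c.toFun
  isC1On := c.isC1On.comp hA hφ c.mapsTo
  mapsTo := hφU.comp c.mapsTo

variable {d : ℕ} {A : Set (Fin d → ℝ)} {U : Set E} {φ : (Fin d → ℝ) → E}

theorem SingularBlock.pullbackCoeff_map (c : SingularBlock A k) (hA : IsOpen A)
    (hφ : ContDiffOn ℝ 1 φ A) (hφU : MapsTo φ A U) (ω : DiffForm E k) :
    EqOn ((c.map hA hφ hφU).pullbackCoeff ω) (c.pullbackCoeff (pullback φ ω))
      (Box.Icc c.block) := by
  intro t ht
  have hφt : DifferentiableAt ℝ φ (c.toFun t) :=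
    (hφ.contDiffAt (hA.mem_nhds (c.mapsTo ht))).differentiableAt one_ne_zero
  have hchain : fderivWithin ℝ (φ ∘ c.toFun) (Box.Icc c.block) t =
      (fderiv ℝ φ (c.toFun t)).comp (fderivWithin ℝ c.toFun (Box.Icc c.block) t) :=
    fderiv_comp_fderivWithin t hφt (c.isC1On.differentiableWithinAt ht)
      (uniqueDiffOn_boxIcc _ t ht)
  simp only [SingularBlock.pullbackCoeff, SingularBlock.map, pullback, hchain]
  rfl

theorem SingularBlock.isIntegrable_map (c : SingularBlock A k) (hA : IsOpen A)
    (hφ : ContDiffOn ℝ 1 φ A) (hφU : MapsTo φ A U) (ω : DiffForm E k) :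
    (c.map hA hφ hφU).IsIntegrable ω ↔ c.IsIntegrable (pullback φ ω) :=
  integrable_congr (c.pullbackCoeff_map hA hφ hφU ω)

theorem SingularBlock.integral_map (c : SingularBlock A k) (hA : IsOpen A)
    (hφ : ContDiffOn ℝ 1 φ A) (hφU : MapsTo φ A U) (ω : DiffForm E k) :
    (c.map hA hφ hφU).integral ω = c.integral (pullback φ ω) :=
  integral_congr (c.pullbackCoeff_map hA hφ hφU ω)

theorem SingularBlock.integral_boundary_map {m : ℕ} (c : SingularBlock A (m + 1)) (hA : IsOpen A)
    (hφ : ContDiffOn ℝ 1 φ A) (hφU : MapsTo φ A U) (ω : DiffForm E m) :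
    Chain.integral (c.map hA hφ hφU).boundary ω = Chain.integral c.boundary (pullback φ ω) := by
  simp only [SingularBlock.integral_boundary, ← SingularBlock.integral_map _ hA hφ hφU]
  rfl

end PushForward

section SupportOfBoundary

variable {E : Type*} [NormedAddCommGroup E] [NormedSpace ℝ E] {U : Set E} {m : ℕ}

theorem SingularBlock.exists_face_eq_of_mem_support_boundary {c : SingularBlock U (m + 1)}
    {s : SingularBlock U m} (hs : s ∈ c.boundary.support) : ∃ i j, c.face i j = s := by
  classical
  obtain ⟨i, -, hi⟩ := Finset.mem_biUnion.1 (Finsupp.support_finsetSum hs)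
  obtain ⟨j, -, hj⟩ := Finset.mem_biUnion.1 (Finsupp.support_finsetSum hi)
  exact ⟨i, j, (Finset.mem_singleton.1 (Finsupp.support_single_subset hj)).symm⟩

theorem SingularBlock.face_mem_support_boundary {c : SingularBlock U (m + 1)}
    (hc : Function.Injective2 c.face) (i : Fin (m + 1)) (j : Fin 2) :
    c.face i j ∈ c.boundary.support := by
  classical
  have hcoeff : c.boundary (c.face i j) = (-1) ^ ((i : ℕ) + 1 + (j : ℕ)) := by
    simp only [SingularBlock.boundary, Finsupp.finsetSum_apply, Finsupp.single_apply, hc.eq_iff]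
    rw [Fintype.sum_eq_single i fun i' hi' => by simp [hi'],
      Fintype.sum_eq_single j fun j' hj' => by simp [hj'], if_pos ⟨rfl, rfl⟩]
  rw [Finsupp.mem_support_iff, hcoeff]
  exact pow_ne_zero _ (by norm_num)

theorem injective2_face_inclusionBlock {A : Set (Fin (m + 1) → ℝ)} (B : Box (Fin (m + 1)))
    (hB : Box.Icc B ⊆ A) : Function.Injective2 (inclusionBlock B hB).face := by
  intro i i' j j' h
  have heq (t : Fin m → ℝ) : (i.insertNth (endpoint B i j) t : Fin (m + 1) → ℝ) =
      i'.insertNth (endpoint B i' j') t := congrFun (congrArg SingularBlock.toFun h) t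
  have hi : i = i' := by
    by_contra hne
    obtain ⟨l, rfl⟩ := Fin.exists_succAbove_eq (Ne.symm hne)
    have hfrozen (t : Fin m → ℝ) : t l = endpoint B (i.succAbove l) j' := by
      simpa using congrFun (heq t) (i.succAbove l)
    exact zero_ne_one ((hfrozen 0).trans (hfrozen 1).symm)
  subst hi
  have hendpoint : endpoint B i j = endpoint B i j' := by simpa using congrFun (heq 0) i
  have hlt := B.lower_lt_upper i
  refine ⟨rfl, ?_⟩
  fin_cases j <;> fin_cases j' <;> simp_all [endpoint, hlt.ne, hlt.ne']

end SupportOfBoundary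

section Flux

variable {m : ℕ}

/-- The coefficient of the restriction of `θ` to the hyperplane where the `i`-th variable equals
`a`, as a function of the remaining variables. -/
noncomputable def sliceCoeff (θ : DiffForm (Fin (m + 1) → ℝ) m) (i : Fin (m + 1)) (a : ℝ)
    (t : Fin m → ℝ) : ℝ :=
  θ (i.insertNth a t) fun l => Pi.single (i.succAbove l) 1

/-- The Riemann integral of `θ` over the block `J` placed in the hyperplane where the `i`-th
variable equals `a`. -/
noncomputable def sliceIntegral (θ : DiffForm (Fin (m + 1) → ℝ) m) (i : Fin (m + 1)) (a : ℝ)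
    (J : Box (Fin m)) : ℝ :=
  integral J IntegrationParams.Riemann (sliceCoeff θ i a) BoxAdditiveMap.volume

/-- The flux of `θ` through the boundary of a block. Unlike the integral over
`(inclusionBlock B hB).boundary`, it involves no ambient set and no proof that it contains `B`. -/
noncomputable def flux (θ : DiffForm (Fin (m + 1) → ℝ) m) (B : Box (Fin (m + 1))) : ℝ :=
  ∑ i : Fin (m + 1), (-1) ^ (i : ℕ) *
    (sliceIntegral θ i (B.upper i) (B.face i) - sliceIntegral θ i (B.lower i) (B.face i))

/-- The flux as an additive function of the block. The slice hypothesis makes each `sliceIntegral`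
additive, so the junk value of a non-existing integral never enters. -/
noncomputable def fluxMap (θ : DiffForm (Fin (m + 1) → ℝ) m) (I : Box (Fin (m + 1)))
    (h : ∀ i, ∀ a ∈ Icc (I.lower i) (I.upper i), Integrable (I.face i) IntegrationParams.Riemann
      (sliceCoeff θ i a) BoxAdditiveMap.volume) : BoxAdditiveMap (Fin (m + 1)) ℝ I where
  toFun := flux θ
  sum_partition_boxes' J hJ π hπ := by
    let F (i : Fin (m + 1)) : BoxAdditiveMap (Fin (m + 1)) ℝ I :=
      BoxAdditiveMap.upperSubLower I i (sliceIntegral θ i) (fun a => (h i a a.2).toBoxAdditive)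
        fun _ _ _ => rfl
    simp only [flux]
    rw [Finset.sum_comm]
    refine Finset.sum_congr rfl fun i _ => ?_
    rw [← Finset.mul_sum]
    exact congrArg _ ((F i).sum_partition_boxes hJ hπ)

variable {A : Set (Fin (m + 1) → ℝ)} {B : Box (Fin (m + 1))}

theorem pullbackCoeff_face_inclusionBlock (hB : Box.Icc B ⊆ A) (θ : DiffForm (Fin (m + 1) → ℝ) m)
    (i : Fin (m + 1)) (j : Fin 2) :
    EqOn (((inclusionBlock B hB).face i j).pullbackCoeff θ) (sliceCoeff θ i (endpoint B i j))
      (Box.Icc (B.face i)) := by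
  intro t ht
  have hderiv : fderivWithin ℝ ((inclusionBlock B hB).face i j).toFun (Box.Icc (B.face i)) t =
      fderiv ℝ (fun t : Fin m → ℝ => (i.insertNth (endpoint B i j) t : Fin (m + 1) → ℝ)) t :=
    ((contDiff_insertNth i _).differentiable one_ne_zero t).fderivWithin
      (uniqueDiffOn_boxIcc _ t ht)
  change θ (i.insertNth (endpoint B i j) t) (fun l => fderivWithin ℝ
    ((inclusionBlock B hB).face i j).toFun (Box.Icc (B.face i)) t (Pi.single l 1)) = _
  simp only [hderiv, fderiv_insertNth_single, sliceCoeff]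

theorem integral_boundary_inclusionBlock (hB : Box.Icc B ⊆ A)
    (θ : DiffForm (Fin (m + 1) → ℝ) m) :
    Chain.integral (inclusionBlock B hB).boundary θ = flux θ B := by
  have hface (i j) : ((inclusionBlock B hB).face i j).integral θ =
      sliceIntegral θ i (endpoint B i j) (B.face i) :=
    integral_congr (pullbackCoeff_face_inclusionBlock hB θ i j)
  rw [SingularBlock.integral_boundary, flux]
  refine Finset.sum_congr rfl fun i _ => ?_
  simp only [hface, Fin.sum_univ_two, endpoint, if_true, one_ne_zero, if_false, Fin.val_zero,
    Fin.val_one]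
  ring

end Flux

section Stokes

variable {E : Type*} [NormedAddCommGroup E] [NormedSpace ℝ E] {U : Set E} {m : ℕ}
  {ω : DiffForm E m} {x : E} {A : Set (Fin (m + 1) → ℝ)} {φ : (Fin (m + 1) → ℝ) → E}
  {p : Fin (m + 1) → ℝ}

theorem FluxIntegrableAround.integrable_sliceCoeff (h : FluxIntegrableAround U ω x)
    (hφ : IsC1Through U x A φ p) {B : Box (Fin (m + 1))} (hB : Box.Icc B ⊆ A)
    (hp : p ∈ Box.Icc B) (i : Fin (m + 1)) (j : Fin 2) :
    Integrable (B.face i) IntegrationParams.Riemann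
      (sliceCoeff (pullback φ ω) i (endpoint B i j)) BoxAdditiveMap.volume :=
  (integrable_congr (pullbackCoeff_face_inclusionBlock hB _ i j)).1
    (h A φ p hφ B hB hp _
      (SingularBlock.face_mem_support_boundary (injective2_face_inclusionBlock B hB) i j))

theorem HasExtDerivAt.hasDensityAt_flux {η : E [⋀^Fin (m + 1)]→L[ℝ] ℝ}
    (h : HasExtDerivAt U ω η x) (hφ : IsC1Through U x A φ p) {I : Box (Fin (m + 1))}
    (hI : Box.Icc I ⊆ A) :
    HasDensityAt (flux (pullback φ ω)) I (η fun i => fderiv ℝ φ p (Pi.single i 1)) p := by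
  intro ε hε K hK
  obtain ⟨δ, hδ, H⟩ := h.2 _ A φ p hφ (fun _ => rfl) ε hε K hK
  refine ⟨δ, hδ, fun J hJ hpJ hlong hratio => ?_⟩
  have hJA : Box.Icc J ⊆ A := (Box.le_iff_Icc.1 hJ).trans hI
  rw [← integral_boundary_inclusionBlock hJA]
  exact H J hJA hpJ hlong hratio

theorem SingularBlock.pullbackCoeff_eq {k : ℕ} {c : SingularBlock U k} {t : Fin k → ℝ}
    (ht : t ∈ Box.Icc c.block) (hc : DifferentiableAt ℝ c.toFun t) (η : DiffForm E k) :
    c.pullbackCoeff η t = η (c.toFun t) fun i => fderiv ℝ c.toFun t (Pi.single i 1) := by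
  rw [SingularBlock.pullbackCoeff, hc.fderivWithin (uniqueDiffOn_boxIcc _ t ht)]
  rfl

theorem SingularBlock.integral_eq_integral_boundary {c : SingularBlock U (m + 1)}
    {η : DiffForm E (m + 1)} (hA : IsOpen A) (hcA : Box.Icc c.block ⊆ A)
    (hc : ContDiffOn ℝ 1 c.toFun A) (hcU : MapsTo c.toFun A U)
    (hder : ∀ x ∈ U, HasExtDerivAt U ω (η x) x) (hη : c.IsIntegrable η) :
    c.integral η = Chain.integral c.boundary ω := by
  have hthrough {p} (hp : p ∈ A) : IsC1Through U (c.toFun p) A c.toFun p :=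
    ⟨hA, hc, hcU, hp, rfl⟩
  have hslice (i) (a) (ha : a ∈ Icc (c.block.lower i) (c.block.upper i)) :
      Integrable (c.block.face i) IntegrationParams.Riemann
        (sliceCoeff (pullback c.toFun ω) i a) BoxAdditiveMap.volume := by
    obtain ⟨J, hJ, hface, j, rfl⟩ := exists_le_face_eq_endpoint_eq c.block i ha
    have hJA : Box.Icc J ⊆ A := (Box.le_iff_Icc.1 hJ).trans hcA
    rw [← hface]
    exact (hder _ (hcU (hJA J.lower_mem_Icc))).1.integrable_sliceCoeff
      (hthrough (hJA J.lower_mem_Icc)) hJA J.lower_mem_Icc i j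
  have hdensity (p) (hp : p ∈ Box.Icc c.block) :
      HasDensityAt (fluxMap (pullback c.toFun ω) c.block hslice) c.block
        (c.pullbackCoeff η p) p := by
    rw [SingularBlock.pullbackCoeff_eq hp
      ((hc.contDiffAt (hA.mem_nhds (hcA hp))).differentiableAt one_ne_zero)]
    exact (hder _ (hcU (hcA hp))).hasDensityAt_flux (hthrough (hcA hp)) hcA
  calc c.integral η = flux (pullback c.toFun ω) c.block :=
      (hη.hasIntegral.mono IntegrationParams.gp_le).unique (hasIntegral_of_hasDensityAt _ hdensity)
    _ = Chain.integral (inclusionBlock c.block hcA).boundary (pullback c.toFun ω) :=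
      (integral_boundary_inclusionBlock hcA _).symm
    _ = Chain.integral c.boundary ω :=
      ((inclusionBlock c.block hcA).integral_boundary_map hA hc hcU ω).symm

end Stokes

section ExteriorDerivative

variable {E : Type*} [NormedAddCommGroup E] [NormedSpace ℝ E] {U : Set E} {m : ℕ}

theorem DerivableAt.hasExtDerivAt_D {ω : DiffForm E m} {x : E} (h : DerivableAt U ω x) :
    HasExtDerivAt U ω (D U ω x) x := by
  rw [D, dif_pos h]
  exact h.choose_spec

theorem Chain.integral_boundary_eq_of_forall {c : Chain U (m + 1)} {ω : DiffForm E m}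
    {η : DiffForm E (m + 1)}
    (h : ∀ s ∈ c.support, s.integral η = Chain.integral s.boundary ω) :
    Chain.integral c η = Chain.integral (Chain.boundary c) ω := by
  rw [Chain.integral_boundary, Chain.integral]
  exact Finsupp.sum_congr fun s hs => by rw [h s hs]

variable {ω : DiffForm E m} {η : DiffForm E (m + 1)}
  {A : Set (Fin (m + 2) → ℝ)} {φ : (Fin (m + 2) → ℝ) → E}

theorem integral_boundary_inclusionBlock_pullback_eq_zero
    (hder : ∀ x ∈ U, HasExtDerivAt U ω (η x) x)
    (hη : ∀ c : SingularBlock U (m + 1), c.IsIntegrable η) (hA : IsOpen A)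
    (hφ : ContDiffOn ℝ 1 φ A) (hφU : MapsTo φ A U) {B : Box (Fin (m + 2))} (hB : Box.Icc B ⊆ A) :
    Chain.integral (inclusionBlock B hB).boundary (pullback φ η) = 0 := by
  set c := (inclusionBlock B hB).map hA hφ hφU
  have hstokes : ∀ s ∈ c.boundary.support, s.integral η = Chain.integral s.boundary ω := by
    intro s hs
    obtain ⟨i, j, rfl⟩ := SingularBlock.exists_face_eq_of_mem_support_boundary hs
    have hι := contDiff_insertNth i (endpoint B i j)
    exact SingularBlock.integral_eq_integral_boundary (hA.preimage hι.continuous)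
      (fun t ht => hB (B.mapsTo_insertNth_face_Icc (endpoint_mem B i j) ht))
      (hφ.comp hι.contDiffOn fun _ ht => ht) (fun _ ht => hφU ht) hder (hη _)
  calc Chain.integral (inclusionBlock B hB).boundary (pullback φ η)
    _ = Chain.integral c.boundary η :=
      ((inclusionBlock B hB).integral_boundary_map hA hφ hφU η).symm
    _ = Chain.integral (Chain.boundary c.boundary) ω :=
      Chain.integral_boundary_eq_of_forall hstokes
    _ = 0 := by rw [SingularBlock.boundary_boundary, Chain.integral, Finsupp.sum_zero_index]

theorem hasExtDerivAt_zero_of_forall (hder : ∀ x ∈ U, HasExtDerivAt U ω (η x) x)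
    (hη : ∀ c : SingularBlock U (m + 1), c.IsIntegrable η) (x : E) :
    HasExtDerivAt U η 0 x := by
  constructor
  · intro A φ p h B hB _ s hs
    obtain ⟨i, j, rfl⟩ := SingularBlock.exists_face_eq_of_mem_support_boundary hs
    exact (SingularBlock.isIntegrable_map _ h.isOpen h.contDiffOn h.mapsTo η).1 (hη _)
  · intro v A φ p h _ ε hε K _
    refine ⟨1, one_pos, fun B hB _ _ _ => ?_⟩
    rw [integral_boundary_inclusionBlock_pullback_eq_zero hder hη h.isOpen h.contDiffOn h.mapsTo]
    simpa using hε

end ExteriorDerivative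

end FluxForm

theorem mainTheorem6_general {E : Type*} [NormedAddCommGroup E] [NormedSpace ℝ E] {m : ℕ}
    {U : Set E} (hU : IsOpen U) {ω : FluxForm.DiffForm E m}
    (hder : ∀ x ∈ U, FluxForm.DerivableAt U ω x)
    (hint : ∀ c : FluxForm.Chain U (m + 1), FluxForm.Chain.IsIntegrable c (FluxForm.D U ω)) :
    (∀ x ∈ U, FluxForm.DerivableAt U (FluxForm.D U ω) x) ∧
      ∀ x ∈ U, FluxForm.D U (FluxForm.D U ω) x = 0 := by
  have hblock (c : FluxForm.SingularBlock U (m + 1)) : c.IsIntegrable (FluxForm.D U ω) :=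
    hint (Finsupp.single c 1) c (by simp)
  have hzero (x : E) : FluxForm.HasExtDerivAt U (FluxForm.D U ω) 0 x :=
    FluxForm.hasExtDerivAt_zero_of_forall (fun y hy => (hder y hy).hasExtDerivAt_D) hblock x
  have hderivable (x : E) : FluxForm.DerivableAt U (FluxForm.D U ω) x := ⟨0, hzero x⟩
  exact ⟨fun x _ => hderivable x,
    fun x hx => (hderivable x).hasExtDerivAt_D.unique hU hx (hzero x)⟩

theorem mainTheorem6 (n m : ℕ) (U : Set (EuclideanSpace ℝ (Fin n))) (hU : IsOpen U)
    (ω : FluxForm.DiffForm (EuclideanSpace ℝ (Fin n)) m) (hcont : ContinuousOn ω U)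
    (hder : ∀ x ∈ U, FluxForm.DerivableAt U ω x)
    (hint : ∀ c : FluxForm.Chain U (m + 1), FluxForm.Chain.IsIntegrable c (FluxForm.D U ω)) :
    (∀ x ∈ U, FluxForm.DerivableAt U (FluxForm.D U ω) x) ∧
      ∀ x ∈ U, FluxForm.D U (FluxForm.D U ω) x = 0 :=
  mainTheorem6_general hU hder hint
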